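/- Let $\Bbbk$ be a field. Let $Q\subseteq\mathbb N^r$ and $Q'\subseteq\mathbb N^{r'}$ be pointed affine semigroups of ranks $r$ and $r'$, that is, finitely generated submonoids whose minimal generators $a_1,\dots,a_n\in\mathbb N^r$ (respectively $a'_1,\dots,a'_{n'}\in\mathbb N^{r'}$) form the columns of a matrix of rank $r$ (respectively $r'$). Let $\mathbb N^n$ act on $\mathbb Z^r$ by $m\cdot c=c+\sum_i m_ia_i$, and let $\mathcal A$ be the corresponding action category: its objects are the elements of $\mathbb Z^r$, its morphisms $c\to d$ are the $m\in\mathbb N^n$ with $m\cdot c=d$, and composition is addition in $\mathbb N^n$. For a small category $\mathcal C$, a $\Bbbk\mathcal C$-module is a functor from $\mathcal C$ to $\Bbbk$-vector spaces. The toric ring $\Bbbk[Q]$, a $\mathbb Z^r$-graded module over $\Bbbk[x_1,\dots,x_n]$ via $x_i\mapsto t^{a_i}$, is regarded as the $\Bbbk\mathcal A$-module that sends $c$ to the homogeneous component $\Bbbk[Q]_c$ and $m\colon c\to d$ to multiplication by $x^m$. Define $\mathcal A'$ and the $\Bbbk\mathcal A'$-module $\Bbbk[Q']$ in the same way. A $\Bbbk\mathcal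 C$-module is free if it is a direct sum of modules $\Bbbk[\mathrm{Hom}_{\mathcal C}(c,-)]$. A minimal projective resolution of $M$ is an exact complex $\cdots\to P_1\to P_0\to M\to 0$ such that $P_0\to M$ and all the maps from $P_n$ onto $\ker(P_{n-1}\to P_{n-2})$, $n\ge 1$ (with $P_{-1}=M$, $P_{-2}=0$), are projective covers; it is a minimal free resolution if moreover all $P_n$ are free. The Betti category of $M$ is the full subcategory of $\mathcal C$ on the objects $c$ such that, for a minimal projective resolution $P_\bullet$ of $M$ and some $n$, the images of $P_n(u)$ for the non-isomorphisms $u\colon b\to c$ of $\mathcal C$ do not together span $P_n(c)$. Let $\mathcal B$ and $\mathcal B'$ be the Betti categories of $\Bbbk[Q]$ and $\Bbbk[Q']$, with inclusion functors $\varrho\colon\mathcal B\to\mathcal A$ and $\varrho'\colon\mathcal B'\to\mathcal A'$. Assume that $\alpha\colon\mathcal B\to\mathcal B'$ is an equivalence of categories, and let $P'_\bullet$ be a minimal free resolution of $\Bbbk[Q']$. Write $\mathrm{res}_{\varrho'\circ\alpha}$ for precomposition with $\varrho'\circ\alpha\colon\mathcal B\to\mathcal A'$, and $\mathrm{ind}_\varrho$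 for left Kan extension along $\varrho$ (the left adjoint of precomposition with $\varrho$). Then the chain complex $\mathrm{ind}_\varrho\,\mathrm{res}_{\varrho'\circ\alpha}P'_\bullet$ is a minimal free resolution of $\Bbbk[Q]$. -/

import Mathlib

open CategoryTheory CategoryTheory.Limits

noncomputable section

namespace ToricBetti

universe u

/-! ### Projective covers and minimal projective resolutions in an abelian category -/

section Abelian

variable {A : Type*} [Category A] [Abelian A]

/-- A superfluous epimorphism `f : L ⟶ M`: for every `g : K ⟶ L`, the morphism `g` is epic if and
only if `f ∘ g` is epic. -/
structure IsSuperfluousEpi {L M : A} (f : L ⟶ M) : Prop where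
  epi : Epi f
  epi_iff : ∀ ⦃K : A⦄ (g : K ⟶ L), Epi g ↔ Epi (g ≫ f)

/-- `f : P ⟶ M` is a projective cover of `M`. -/
structure IsProjectiveCover {P M : A} (f : P ⟶ M) : Prop where
  projective : Projective P
  superfluous : IsSuperfluousEpi f

/-- The chain complex `P` with the augmentation `ε : P₀ ⟶ M` is a minimal projective resolution
of `M`: it is exact, and `P₀ ⟶ M`, `P₁ ⟶ ker ε` and `Pₙ₊₂ ⟶ ker dₙ₊₁` are projective covers.
(Exactness is the surjectivity of these maps onto the kernels.) -/
structure IsMinimalProjectiveResolution {M : A} (P : ChainComplex A ℕ) (ε : P.X 0 ⟶ M) :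
    Prop where
  d_comp_augmentation : P.d 1 0 ≫ ε = 0
  cover_augmentation : IsProjectiveCover ε
  cover_zero : IsProjectiveCover (kernel.lift ε (P.d 1 0) d_comp_augmentation)
  cover_succ : ∀ n : ℕ, IsProjectiveCover
    (kernel.lift (P.d (n + 1) n) (P.d (n + 2) (n + 1)) (P.d_comp_d (n + 2) (n + 1) n))

end Abelian

/-! ### Modules over a small category -/

section CatModules

variable (k : Type u) [CommRing k] (C : Type) [SmallCategory C]

/-- The category of `kC`-modules: functors from `C` to `k`-modules, and natural
transformations. -/
abbrev CatMod := C ⥤ ModuleCat.{u} k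

variable {C}

/-- The free `kC`-module `⨁_c ⨁_{b ∈ B(c)} k[Hom(c, -)]` on an `(obj C)`-set `B`: its value at `d`
has as basis all triples `(c, b, f)` with `b ∈ B(c)` and `f : c ⟶ d`, and morphisms of `C` act by
composition. -/
def freeModule (B : C → Type u) : CatMod k C where
  obj d := ModuleCat.of k ((Σ c : C, B c × (c ⟶ d)) →₀ k)
  map g := ModuleCat.ofHom
    (Finsupp.lmapDomain k k (fun x => ⟨x.1, x.2.1, x.2.2 ≫ g⟩))
  map_id d := by
    simp only [Category.comp_id]
    ext : 1
    exact Finsupp.lmapDomain_id k k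
  map_comp g h := by
    ext : 1
    simp only [← Category.assoc]
    exact Finsupp.lmapDomain_comp k k
      (fun x : Σ c : C, B c × (c ⟶ _) =>
        (Sigma.mk x.1 (x.2.1, x.2.2 ≫ g) : Σ c : C, B c × (c ⟶ _)))
      (fun x : Σ c : C, B c × (c ⟶ _) =>
        (Sigma.mk x.1 (x.2.1, x.2.2 ≫ h) : Σ c : C, B c × (c ⟶ _)))

variable {k}

/-- A `kC`-module is free if it is isomorphic to the free module on some `(obj C)`-set. -/
def IsFree (F : CatMod k C) : Prop :=
  ∃ B : C → Type u, Nonempty (F ≅ freeModule k B)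

/-- A minimal free resolution: a minimal projective resolution by free modules. -/
structure IsMinimalFreeResolution {M : CatMod k C} (P : ChainComplex (CatMod k C) ℕ)
    (ε : P.X 0 ⟶ M) : Prop extends IsMinimalProjectiveResolution P ε where
  free : ∀ n : ℕ, IsFree (P.X n)

/-- `jrad M (c)`: the sum of the images of `M(u)` over all non-isomorphisms `u : b ⟶ c`. -/
def jrad (M : CatMod k C) (c : C) : Submodule k (M.obj c) :=
  ⨆ (b : C) (u : b ⟶ c) (_ : ¬ IsIso u), LinearMap.range (M.map u).hom

/-- The value at `c` of the splitting functor, `M(c) / jrad M (c)`. -/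
abbrev spl (M : CatMod k C) (c : C) : Type u := M.obj c ⧸ jrad M c

/-- The minimal support of a `kC`-module, as a set of isomorphism classes of objects of `C`. -/
def minSupp (M : CatMod k C) : Set (Quotient (isIsomorphicSetoid C)) :=
  {x | ∃ c : C, Quotient.mk (isIsomorphicSetoid C) c = x ∧ Nontrivial (spl M c)}

/-- The minimal support of a chain complex of `kC`-modules. -/
def minSuppComplex (P : ChainComplex (CatMod k C) ℕ) :
    Set (Quotient (isIsomorphicSetoid C)) :=
  ⋃ n : ℕ, minSupp (P.X n)

/-- The objects of the Betti category of `M`: those `c` whose isomorphism class lies in the minimal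
support of a minimal projective resolution of `M`. (Minimal projective resolutions are unique up to
isomorphism, so this does not depend on the choice of the resolution.) -/
def bettiProperty (M : CatMod k C) : ObjectProperty C := fun c =>
  ∃ (P : ChainComplex (CatMod k C) ℕ) (ε : P.X 0 ⟶ M),
    IsMinimalProjectiveResolution P ε ∧
      Quotient.mk (isIsomorphicSetoid C) c ∈ minSuppComplex P

/-- The Betti category of `M`, a full subcategory of `C`. -/
abbrev BettiCategory (M : CatMod k C) : Type := (bettiProperty M).FullSubcategory

/-- The inclusion functor of the Betti category of `M` into `C`. -/
abbrev bettiInclusion (M : CatMod k C) : BettiCategory M ⥤ C := (bettiProperty M).ι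

end CatModules

/-! ### Restriction and induction -/

section IndRes

variable (k : Type u) [CommRing k] {C D : Type} [SmallCategory C] [SmallCategory D]

/-- Restriction along `F : C ⥤ D`: precomposition with `F`. -/
abbrev res (F : C ⥤ D) : CatMod k D ⥤ CatMod k C :=
  (Functor.whiskeringLeft C D (ModuleCat.{u} k)).obj F

/-- Induction along `F : C ⥤ D`, the left adjoint of restriction: the left Kan extension
along `F`. -/
abbrev ind (F : C ⥤ D) : CatMod k C ⥤ CatMod k D := F.lan

instance (F : C ⥤ D) : (res k F).PreservesZeroMorphisms where
  map_zero _ _ := rfl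

instance (F : C ⥤ D) : (ind k F).PreservesZeroMorphisms :=
  have : (ind k F).IsLeftAdjoint := (F.lanAdjunction (ModuleCat.{u} k)).isLeftAdjoint
  Functor.preservesZeroMorphisms_of_isLeftAdjoint _

/-- The chain complex `ind_F (res_G P)`. -/
def indResComplex {E : Type} [SmallCategory E] (F : C ⥤ D) (G : C ⥤ E)
    (P : ChainComplex (CatMod k E) ℕ) : ChainComplex (CatMod k D) ℕ :=
  ((ind k F).mapHomologicalComplex (ComplexShape.down ℕ)).obj
    (((res k G).mapHomologicalComplex (ComplexShape.down ℕ)).obj P)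

end IndRes

/-! ### Pointed affine semigroups and toric rings -/

/-- A pointed affine semigroup of rank `r`, embedded in `ℕ^r`, with its minimal generators
`a_1, …, a_n` listed: no `a_j` is a combination of the others with coefficients in `ℕ` (so they are
distinct and non-zero), and the matrix with columns `a_1, …, a_n` has rank `r`. -/
structure PointedAffineSemigroup (r n : ℕ) where
  /-- the semigroup `Q` -/
  carrier : AddSubmonoid (Fin r → ℕ)
  /-- the minimal generators -/
  gen : Fin n → Fin r → ℕ
  closure_gen : AddSubmonoid.closure (Set.range gen) = carrier
  gen_irredundant : ∀ j, gen j ∉ AddSubmonoid.closure (gen '' {j}ᶜ)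
  rank_eq : (Matrix.of fun (i : Fin r) (j : Fin n) => (gen j i : ℚ)).rank = r

namespace PointedAffineSemigroup

variable {r n : ℕ} (Q : PointedAffineSemigroup r n)

/-- The generator `a_i` as an element of `Q`. -/
def genMem (i : Fin n) : Q.carrier :=
  ⟨Q.gen i, Q.closure_gen ▸ AddSubmonoid.subset_closure (Set.mem_range_self i)⟩

/-- The degree map `Q ⊆ ℕ^r ⊆ ℤ^r`. -/
def toDegree : Q.carrier →+ (Fin r → ℤ) where
  toFun q i := ((q : Fin r → ℕ) i : ℤ)
  map_zero' := by ext; simp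
  map_add' x y := by ext; simp

/-- The homomorphism `ℕ^n → Q`, `m ↦ m_1 a_1 + ⋯ + m_n a_n`, given by the matrix `A`. -/
def monomialSum : (Fin n →₀ ℕ) →+ Q.carrier where
  toFun m := m.sum fun i e => e • Q.genMem i
  map_zero' := Finsupp.sum_zero_index
  map_add' _ _ := Finsupp.sum_add_index' (fun _ => zero_nsmul _) (fun _ _ _ => add_nsmul _ _ _)

/-- The set `ℤ^r`, with the action of `ℕ^n` by translation through the matrix `A`. -/
def Degrees (_ : PointedAffineSemigroup r n) : Type := Fin r → ℤ

/-- `m ∈ ℕ^n` sends `c ∈ ℤ^r` to `A m + c`. -/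
instance : MulAction (Multiplicative (Fin n →₀ ℕ)) Q.Degrees where
  smul m c := fun i => Q.toDegree (Q.monomialSum m.toAdd) i + c i
  one_smul c := by
    funext i
    change Q.toDegree (Q.monomialSum 0) i + c i = c i
    rw [map_zero, map_zero]
    exact zero_add _
  mul_smul x y c := by
    funext i
    change Q.toDegree (Q.monomialSum (x.toAdd + y.toAdd)) i + c i =
      Q.toDegree (Q.monomialSum x.toAdd) i + (Q.toDegree (Q.monomialSum y.toAdd) i + c i)
    rw [map_add, map_add]
    exact add_assoc _ _ _

/-- The action category of `ℕ^n` acting on `ℤ^r` through `A`: its objects are the elements of `ℤ^r`,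
and the morphisms `c ⟶ d` are the `m ∈ ℕ^n` with `A m + c = d`. -/
abbrev ActCat : Type := ActionCategory (Multiplicative (Fin n →₀ ℕ)) Q.Degrees

/-- The degree in `ℤ^r` that is the given object of the action category. -/
def degreeOf (c : Q.ActCat) : Fin r → ℤ := c.back

/-- The monomial `m ∈ ℕ^n` that is the given morphism of the action category. -/
def monomialOf {c d : Q.ActCat} (f : c ⟶ d) : Fin n →₀ ℕ :=
  Multiplicative.toAdd (f.val : Multiplicative (Fin n →₀ ℕ))

theorem monomialOf_spec {c d : Q.ActCat} (f : c ⟶ d) :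
    Q.toDegree (Q.monomialSum (Q.monomialOf f)) + Q.degreeOf c = Q.degreeOf d :=
  (f.property : (actionAsFunctor _ Q.Degrees).map f.val c.2 = d.2)

variable (k : Type u) [Field k]

/-- The toric ring `k[Q]`. -/
abbrev ToricRing : Type u := AddMonoidAlgebra k Q.carrier

/-- The homomorphism `k[x_1, …, x_n] → k[Q]` with `x_i ↦ t^{a_i}`, through which `k[Q]` is a module
over the polynomial ring. -/
def toricHom : MvPolynomial (Fin n) k →ₐ[k] Q.ToricRing k :=
  MvPolynomial.aeval fun i => AddMonoidAlgebra.single (Q.genMem i) 1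

theorem toricHom_monomial (m : Fin n →₀ ℕ) :
    Q.toricHom k (MvPolynomial.monomial m 1) = AddMonoidAlgebra.single (Q.monomialSum m) 1 := by
  induction m using Finsupp.induction_linear with
  | zero =>
    rw [map_zero]
    exact map_one _
  | add x y hx hy =>
    have h : (MvPolynomial.monomial (x + y) (1 : k)) =
        MvPolynomial.monomial x 1 * MvPolynomial.monomial y 1 := by
      rw [MvPolynomial.monomial_mul, one_mul]
    rw [h, map_mul, hx, hy, AddMonoidAlgebra.single_mul_single, one_mul, map_add]
  | single i e =>
    have h : Q.monomialSum (Finsupp.single i e) = e • Q.genMem i :=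
      Finsupp.sum_single_index (h := fun i e => e • Q.genMem i) (zero_nsmul _)
    rw [h, toricHom, MvPolynomial.aeval_monomial, map_one, one_mul,
      Finsupp.prod_single_index (h := fun i e => AddMonoidAlgebra.single (Q.genMem i) (1 : k) ^ e)
        (pow_zero _), AddMonoidAlgebra.single_pow, one_pow]

/-- The homogeneous component of degree `c ∈ ℤ^r` of `k[Q]`. -/
abbrev component (c : Fin r → ℤ) : Submodule k (Q.ToricRing k) :=
  AddMonoidAlgebra.gradeBy k Q.toDegree c

theorem toricHom_mul_mem {c d : Q.ActCat} (f : c ⟶ d) (x : Q.ToricRing k)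
    (hx : x ∈ Q.component k (Q.degreeOf c)) :
    Q.toricHom k (MvPolynomial.monomial (Q.monomialOf f) 1) * x ∈
      Q.component k (Q.degreeOf d) := by
  rw [toricHom_monomial, ← Q.monomialOf_spec f]
  exact SetLike.mul_mem_graded
    (AddMonoidAlgebra.single_mem_gradeBy Q.toDegree (Q.monomialSum (Q.monomialOf f)) (1 : k)) hx

/-- The `ℤ^r`-graded `k[x_1, …, x_n]`-module `k[Q]` as a module over the action category: an object
`c` is sent to the homogeneous component of degree `c`, and a morphism `m : c ⟶ d` to the
multiplication by the monomial `x^m`. -/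
def toricModule : CatMod k Q.ActCat where
  obj c := ModuleCat.of k (Q.component k (Q.degreeOf c))
  map f := ModuleCat.ofHom
    ((LinearMap.mulLeft k (Q.toricHom k (MvPolynomial.monomial (Q.monomialOf f) 1))).restrict
      (Q.toricHom_mul_mem k f))
  map_id c := by
    refine ModuleCat.hom_ext (LinearMap.ext fun x => Subtype.ext ?_)
    change Q.toricHom k (MvPolynomial.monomial 0 1) * (x : Q.ToricRing k) = x
    rw [toricHom_monomial, map_zero]
    exact one_mul _
  map_comp {c d e} f g := by
    refine ModuleCat.hom_ext (LinearMap.ext fun x => Subtype.ext ?_)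
    change Q.toricHom k (MvPolynomial.monomial (Q.monomialOf g + Q.monomialOf f) 1) *
        (x : Q.ToricRing k) =
      Q.toricHom k (MvPolynomial.monomial (Q.monomialOf g) 1) *
        (Q.toricHom k (MvPolynomial.monomial (Q.monomialOf f) 1) * (x : Q.ToricRing k))
    rw [← mul_assoc, ← map_mul, MvPolynomial.monomial_mul, one_mul]

end PointedAffineSemigroup

end ToricBetti

end

noncomputable section

namespace ToricBetti

universe u

/-! ### Projective covers and minimal resolutions -/

section Cover

variable {A : Type*} [Category A]

/-! The restricted toric module depends only on the Betti category. Betti degrees lie in `Q`, where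
every component of the toric ring is one-dimensional; the sum of coefficients identifies all these
components with `k`, and monomials then act as the identity. So the restriction of the toric module
of `Q` to its Betti category is the constant functor `k`, and so is the restriction of the toric
module of `Q'` along `α` and the inclusion (`nonempty_res_toricModule_iso_const`). It remains to see
that a minimal resolution can be moved to the Betti category and back without loss.

Moving there: the action category has only trivial endomorphisms and isomorphisms, and total degree
strictly grows along non-isomorphisms starting in `Q`. Hence Nakayama's lemma holds for modules
supported in `Q`, and their projective covers are exactly the free covers with kernel in the
radical, with generators in the degrees where `spl` is nonzero
(`IsProjectiveCover.exists_iso_freeModule`). For a minimal resolution these degrees are Betti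
degrees by definition, so restriction keeps the terms projective and the kernels in the radical
(`IsProjectiveCover.map_res`): it yields a minimal projective resolution of the constant functor.

Moving back: a free module with generators in a full subcategory is induced from its restriction
(`isIso_counit_freeModule`), so a minimal resolution `P` of the toric module of `Q` satisfies `ind
(res P) ≅ P`. Uniqueness of minimal projective resolutions over the Betti category identifies the
restrictions of `P'` and `P`, and inducing gives a complex isomorphic to `P`. -/

theorem IsProjectiveCover.of_arrow_iso {L M L' M' : A} {f : L ⟶ M} {f' : L' ⟶ M'}
    (hf : IsProjectiveCover f) (g : L' ≅ L) (e : M' ≅ M) (w : f' ≫ e.hom = g.hom ≫ f) :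
    IsProjectiveCover f' := by
  have := hf.projective
  have := hf.superfluous.epi
  obtain rfl : f' = g.hom ≫ f ≫ e.inv := by
    rw [← Category.assoc, ← w, Category.assoc, e.hom_inv_id, Category.comp_id]
  refine ⟨Projective.of_iso g.symm inferInstance, inferInstance, fun K h => ?_⟩
  have h1 : Epi h ↔ Epi (h ≫ g.hom) :=
    ⟨fun _ => inferInstance, fun _ => by
      have : h = (h ≫ g.hom) ≫ g.inv := by simp
      rw [this]; infer_instance⟩
  rw [h1, hf.superfluous.epi_iff]
  refine ⟨fun _ => ?_, fun _ => ?_⟩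
  · have : h ≫ g.hom ≫ f ≫ e.inv = ((h ≫ g.hom) ≫ f) ≫ e.inv := by simp
    rw [this]; infer_instance
  · have : (h ≫ g.hom) ≫ f = (h ≫ g.hom ≫ f ≫ e.inv) ≫ e.hom := by simp
    rw [this]; infer_instance

/-- A morphism between projective covers that lifts an isomorphism is an isomorphism. -/
theorem IsProjectiveCover.isIso_of_lift {L M L' M' : A} {f : L ⟶ M} {f' : L' ⟶ M'}
    (hf : IsProjectiveCover f) (hf' : IsProjectiveCover f') (e : M ⟶ M') [IsIso e]
    (g : L ⟶ L') (w : g ≫ f' = f ≫ e) : IsIso g := by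
  have := hf.superfluous.epi
  have := hf'.superfluous.epi
  have := hf'.projective
  have hg : Epi g := (hf'.superfluous.epi_iff g).2 (by rw [w]; infer_instance)
  -- The section `s` of `g` is epic as well, because `s ≫ f` is and `f` is superfluous; an epic
  -- split monomorphism is invertible.
  let s : L' ⟶ L := Projective.factorThru (𝟙 L') g
  have hs : s ≫ g = 𝟙 L' := Projective.factorThru_comp _ _
  have hsf : s ≫ f = f' ≫ inv e := by
    rw [IsIso.eq_comp_inv, Category.assoc, ← w, ← Category.assoc, hs, Category.id_comp]
  have hse : Epi s := (hf.superfluous.epi_iff s).2 (by rw [hsf]; infer_instance)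
  have : IsSplitMono s := ⟨⟨g, hs⟩⟩
  have : IsIso s := isIso_of_epi_of_isSplitMono s
  have : g = inv s := (IsIso.inv_eq_of_hom_inv_id hs).symm
  rw [this]; infer_instance

end Cover

section Abelian

variable {A : Type*} [Category A] [Abelian A]

/-- The lift of a projective cover to the kernel, transported along an isomorphism. -/
theorem IsProjectiveCover.kernel_lift_of_iso {X Y Z X' Y' Z' : A} {f : X ⟶ Y} {g : Y ⟶ Z}
    {f' : X' ⟶ Y'} {g' : Y' ⟶ Z'} {w : f ≫ g = 0} (h : IsProjectiveCover (kernel.lift g f w))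
    (a : X' ≅ X) (b : Y' ≅ Y) (c : Z' ≅ Z) (hab : f' ≫ b.hom = a.hom ≫ f)
    (hbc : g' ≫ c.hom = b.hom ≫ g) (w' : f' ≫ g' = 0) :
    IsProjectiveCover (kernel.lift g' f' w') :=
  h.of_arrow_iso a (kernel.mapIso g' g b c hbc) (by
    rw [← cancel_mono (kernel.ι g)]
    simp [hab])

theorem IsMinimalProjectiveResolution.of_iso {M M' : A} {P P' : ChainComplex A ℕ}
    {ε : P.X 0 ⟶ M} (h : IsMinimalProjectiveResolution P ε) (φ : P' ≅ P) (e : M' ≅ M)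
    {ε' : P'.X 0 ⟶ M'} (w : ε' ≫ e.hom = φ.hom.f 0 ≫ ε) :
    IsMinimalProjectiveResolution P' ε' := by
  let a (n : ℕ) : P'.X n ≅ P.X n := (HomologicalComplex.eval A _ n).mapIso φ
  have hd (i j : ℕ) : P'.d i j ≫ (a j).hom = (a i).hom ≫ P.d i j := (φ.hom.comm i j).symm
  have w0 : P'.d 1 0 ≫ ε' = 0 := by
    rw [← cancel_mono e.hom, Category.assoc, w, zero_comp, ← Category.assoc]
    erw [hd 1 0]
    rw [Category.assoc, h.d_comp_augmentation, comp_zero]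
  exact
    { d_comp_augmentation := w0
      cover_augmentation := h.cover_augmentation.of_arrow_iso (a 0) e w
      cover_zero := h.cover_zero.kernel_lift_of_iso (a 1) (a 0) e (hd 1 0) w w0
      cover_succ := fun n =>
        (h.cover_succ n).kernel_lift_of_iso (a (n + 2)) (a (n + 1)) (a n) (hd _ _) (hd _ _) _ }

theorem IsMinimalProjectiveResolution.projective {M : A} {P : ChainComplex A ℕ} {ε : P.X 0 ⟶ M}
    (h : IsMinimalProjectiveResolution P ε) : ∀ n, Projective (P.X n)
  | 0 => h.cover_augmentation.projective
  | 1 => h.cover_zero.projective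
  | n + 2 => (h.cover_succ n).projective

/-- If `X ⟶ ker g` is epic, a morphism from a projective object that is killed by `g` lifts. -/
theorem exists_lift_of_epi_kernel_lift {X Y Z R : A} [Projective R] (f : X ⟶ Y) (g : Y ⟶ Z)
    (w : f ≫ g = 0) [Epi (kernel.lift g f w)] (x : R ⟶ Y) (hx : x ≫ g = 0) :
    ∃ y : R ⟶ X, y ≫ f = x := by
  refine ⟨Projective.factorThru (kernel.lift g x hx) (kernel.lift g f w), ?_⟩
  have h := congrArg (· ≫ kernel.ι g)
    (Projective.factorThru_comp (kernel.lift g x hx) (kernel.lift g f w))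
  simp only [Category.assoc, kernel.lift_ι] at h
  exact h

theorem isIso_kernel_map {Y Z Y' Z' : A} (g : Y ⟶ Z) (g' : Y' ⟶ Z') (b : Y ⟶ Y') (c : Z ⟶ Z')
    (w : g ≫ c = b ≫ g') [IsIso b] [IsIso c] : IsIso (kernel.map g g' b c w) :=
  (kernel.mapIso g g' (asIso b) (asIso c) w).isIso_hom

/-- Minimal projective resolutions of isomorphic objects are isomorphic. -/
theorem IsMinimalProjectiveResolution.nonempty_iso {M M' : A} {P P' : ChainComplex A ℕ}
    {ε : P.X 0 ⟶ M} {ε' : P'.X 0 ⟶ M'} (h : IsMinimalProjectiveResolution P ε)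
    (h' : IsMinimalProjectiveResolution P' ε') (e : M ≅ M') : Nonempty (P ≅ P') := by
  have := h.projective
  have := h'.cover_augmentation.superfluous.epi
  have := h'.cover_zero.superfluous.epi
  have := fun n => (h'.cover_succ n).superfluous.epi
  obtain ⟨f0, hf0⟩ : ∃ f0 : P.X 0 ⟶ P'.X 0, f0 ≫ ε' = ε ≫ e.hom :=
    ⟨Projective.factorThru (ε ≫ e.hom) ε', Projective.factorThru_comp _ _⟩
  obtain ⟨f1, hf1⟩ := exists_lift_of_epi_kernel_lift (P'.d 1 0) ε' h'.d_comp_augmentation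
    (P.d 1 0 ≫ f0) (by
      rw [Category.assoc, hf0, ← Category.assoc, h.d_comp_augmentation, zero_comp])
  let F : P ⟶ P' := ChainComplex.mkHom P P' f0 f1 hf1 (fun n p => by
    have H := exists_lift_of_epi_kernel_lift (P'.d (n + 2) (n + 1)) (P'.d (n + 1) n)
      (P'.d_comp_d _ _ _) (P.d (n + 2) (n + 1) ≫ p.2.1) (by
        rw [Category.assoc, p.2.2, ← Category.assoc, P.d_comp_d, zero_comp])
    exact ⟨H.choose, H.choose_spec⟩)
  have i0 : IsIso (F.f 0) :=
    h.cover_augmentation.isIso_of_lift h'.cover_augmentation e.hom _ hf0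
  have i1 : IsIso (F.f 1) := by
    have := isIso_kernel_map ε ε' (F.f 0) e.hom hf0.symm
    refine h.cover_zero.isIso_of_lift h'.cover_zero
      (kernel.map ε ε' (F.f 0) e.hom hf0.symm) _ ?_
    rw [← cancel_mono (kernel.ι _)]
    simp
  -- Two consecutive components are carried along, since the map induced on the kernel of `P.d (n +
  -- 1) n` needs both of them to be invertible.
  have i : ∀ n, IsIso (F.f n) ∧ IsIso (F.f (n + 1)) := by
    intro n
    induction n with
    | zero => exact ⟨i0, i1⟩
    | succ n ih =>
      refine ⟨ih.2, ?_⟩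
      obtain ⟨_, _⟩ := ih
      have := isIso_kernel_map (P.d (n + 1) n) (P'.d (n + 1) n) (F.f (n + 1)) (F.f n)
        (F.comm _ _).symm
      refine (h.cover_succ n).isIso_of_lift (h'.cover_succ n)
        (kernel.map (P.d (n + 1) n) (P'.d (n + 1) n) (F.f (n + 1)) (F.f n) (F.comm _ _).symm) _ ?_
      rw [← cancel_mono (kernel.ι _)]
      simp
  have := fun n => (i n).1
  have : IsIso F := HomologicalComplex.Hom.isIso_of_components F
  exact ⟨asIso F⟩

theorem IsProjectiveCover.kernel_lift_map {B : Type*} [Category B] [Abelian B] (T : A ⥤ B)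
    [T.PreservesZeroMorphisms] [PreservesFiniteLimits T] {X Y Z : A} {f : X ⟶ Y} {g : Y ⟶ Z}
    {w : f ≫ g = 0} (h : IsProjectiveCover (T.map (kernel.lift g f w)))
    (w' : T.map f ≫ T.map g = 0) :
    IsProjectiveCover (kernel.lift (T.map g) (T.map f) w') :=
  h.of_arrow_iso (Iso.refl _) (PreservesKernel.iso T g).symm (by
    rw [Iso.symm_hom, Iso.comp_inv_eq, PreservesKernel.iso_hom, Iso.refl_hom, Category.id_comp,
      map_lift_kernelComparison])

/-- An additive functor that preserves kernels, and turns the projective covers of a minimal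
projective resolution into projective covers, preserves the resolution. -/
theorem IsMinimalProjectiveResolution.map {B : Type*} [Category B] [Abelian B] (T : A ⥤ B)
    [T.PreservesZeroMorphisms] [PreservesFiniteLimits T] {M : A} {P : ChainComplex A ℕ}
    {ε : P.X 0 ⟶ M} (h : IsMinimalProjectiveResolution P ε)
    (h_aug : IsProjectiveCover (T.map ε))
    (h_zero : IsProjectiveCover (T.map (kernel.lift ε (P.d 1 0) h.d_comp_augmentation)))
    (h_succ : ∀ n, IsProjectiveCover (T.map (kernel.lift (P.d (n + 1) n) (P.d (n + 2) (n + 1))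
      (P.d_comp_d (n + 2) (n + 1) n)))) :
    IsMinimalProjectiveResolution ((T.mapHomologicalComplex (ComplexShape.down ℕ)).obj P)
      (T.map ε) where
  d_comp_augmentation := by
    change T.map (P.d 1 0) ≫ T.map ε = 0
    rw [← T.map_comp, h.d_comp_augmentation, T.map_zero]
  cover_augmentation := h_aug
  cover_zero := h_zero.kernel_lift_map T _
  cover_succ n := (h_succ n).kernel_lift_map T _

theorem IsProjectiveCover.map_of_isEquivalence {B : Type*} [Category B] [Abelian B] (T : A ⥤ B)
    [T.IsEquivalence] {L M : A} {f : L ⟶ M} (h : IsProjectiveCover f) :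
    IsProjectiveCover (T.map f) := by
  have := h.superfluous.epi
  refine ⟨(T.asEquivalence.map_projective_iff L).2 h.projective, inferInstance, fun K g => ?_⟩
  obtain ⟨g', hg'⟩ := T.map_surjective ((T.objObjPreimageIso K).hom ≫ g)
  have key {X Y : A} (x : X ⟶ Y) : Epi (T.map x) ↔ Epi x :=
    ⟨fun _ => T.epi_of_epi_map ‹_›, fun _ => inferInstance⟩
  have hg : g = (T.objObjPreimageIso K).inv ≫ T.map g' := by simp [hg']
  have hc {Z : B} (z : T.obj (T.objPreimage K) ⟶ Z) :
      Epi ((T.objObjPreimageIso K).inv ≫ z) ↔ Epi z :=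
    ⟨fun _ => epi_of_epi (T.objObjPreimageIso K).inv z, fun _ => inferInstance⟩
  rw [hg, Category.assoc, ← T.map_comp, hc, hc, key, key]
  exact h.superfluous.epi_iff g'

end Abelian

/-! ### Free modules -/

section Free

variable {k : Type u} [CommRing k] {C D : Type} [SmallCategory C] [SmallCategory D]
  (S : C → Type u)

variable (k) in
/-- The basis element `(c, s, f)` of a free module. -/
def freeGen {c d : C} (s : S c) (f : c ⟶ d) : (freeModule k S).obj d :=
  (Finsupp.single (⟨c, s, f⟩ : Σ c : C, S c × (c ⟶ d)) 1 : (Σ c : C, S c × (c ⟶ d)) →₀ k)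

variable {S}

@[simp]
theorem freeModule_map_freeGen {c d e : C} (s : S c) (f : c ⟶ d) (g : d ⟶ e) :
    ((freeModule k S).map g).hom (freeGen k S s f) = freeGen k S s (f ≫ g) :=
  Finsupp.mapDomain_single

theorem freeModule_linearMap_ext {d : C} {N : Type*} [AddCommGroup N] [Module k N]
    {φ ψ : (freeModule k S).obj d →ₗ[k] N}
    (h : ∀ (c : C) (s : S c) (f : c ⟶ d), φ (freeGen k S s f) = ψ (freeGen k S s f)) : φ = ψ :=
  Finsupp.lhom_ext' fun x => LinearMap.ext_ring (h x.1 x.2.1 x.2.2)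

theorem freeModule_submodule_eq_top {d : C} (N : Submodule k ((freeModule k S).obj d))
    (h : ∀ (c : C) (s : S c) (f : c ⟶ d), freeGen k S s f ∈ N) : N = ⊤ := by
  rw [← Submodule.ker_mkQ N, LinearMap.ker_eq_top]
  exact freeModule_linearMap_ext fun c s f => (Submodule.Quotient.mk_eq_zero N).2 (h c s f)

theorem nonempty_of_nontrivial_freeModule_obj {d : C} (h : Nontrivial ((freeModule k S).obj d)) :
    ∃ c : C, Nonempty (S c) ∧ Nonempty (c ⟶ d) := by
  by_contra! H
  refine not_subsingleton_iff_nontrivial.2 h ?_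
  have : IsEmpty (Σ c : C, S c × (c ⟶ d)) :=
    ⟨fun x => (H x.1 ⟨x.2.1⟩).false x.2.2⟩
  exact (inferInstance : Subsingleton ((Σ c : C, S c × (c ⟶ d)) →₀ k))

/-- The linear map on a value of a free module with prescribed values on the basis. -/
def freeLift {d : C} {N : Type*} [AddCommGroup N] [Module k N]
    (y : ∀ (c : C), S c → (c ⟶ d) → N) : (freeModule k S).obj d →ₗ[k] N :=
  (Finsupp.linearCombination k fun x : (Σ c : C, S c × (c ⟶ d)) => y x.1 x.2.1 x.2.2 :
    ((Σ c : C, S c × (c ⟶ d)) →₀ k) →ₗ[k] N)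

@[simp]
theorem freeLift_freeGen {c d : C} {N : Type*} [AddCommGroup N] [Module k N]
    (y : ∀ (c : C), S c → (c ⟶ d) → N) (s : S c) (f : c ⟶ d) :
    freeLift (k := k) y (freeGen k S s f) = y c s f :=
  (Finsupp.linearCombination_single k 1 _).trans (one_smul k _)

/-- The morphism from a restricted free module with prescribed values on the bases. -/
def resFreeDesc (ρ : D ⥤ C) (N : CatMod k D)
    (y : ∀ (d : D) (c : C), S c → (c ⟶ ρ.obj d) → N.obj d)
    (hy : ∀ (d e : D) (g : d ⟶ e) (c : C) (s : S c) (f : c ⟶ ρ.obj d),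
      y e c s (f ≫ ρ.map g) = (N.map g).hom (y d c s f)) : ρ ⋙ freeModule k S ⟶ N where
  app d := ModuleCat.ofHom (freeLift (y d))
  naturality d e g := by
    refine ModuleCat.hom_ext (freeModule_linearMap_ext fun c s f => ?_)
    change freeLift (y e) (((freeModule k S).map (ρ.map g)).hom (freeGen k S s f)) =
      (N.map g).hom (freeLift (y d) (freeGen k S s f))
    rw [freeModule_map_freeGen, freeLift_freeGen, freeLift_freeGen, hy]

/-- The morphism from a free module with prescribed values on the generators. -/
def freeDesc (N : CatMod k C) (y : ∀ c : C, S c → N.obj c) : freeModule k S ⟶ N :=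
  resFreeDesc (𝟭 C) N (fun _ c s f => (N.map f).hom (y c s)) (fun d e g c s f => by simp)

theorem freeDesc_freeGen (N : CatMod k C) (y : ∀ c : C, S c → N.obj c) {c d : C} (s : S c)
    (f : c ⟶ d) : ((freeDesc N y).app d).hom (freeGen k S s f) = (N.map f).hom (y c s) :=
  freeLift_freeGen _ _ _

theorem freeModule_hom_ext {N : CatMod k C} {φ ψ : freeModule k S ⟶ N}
    (h : ∀ (c : C) (s : S c), (φ.app c).hom (freeGen k S s (𝟙 c)) =
      (ψ.app c).hom (freeGen k S s (𝟙 c))) : φ = ψ := by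
  ext d : 2
  refine ModuleCat.hom_ext (freeModule_linearMap_ext fun c s f => ?_)
  have hf : freeGen k S s f = ((freeModule k S).map f).hom (freeGen k S s (𝟙 c)) := by simp
  rw [hf]
  have h1 := ConcreteCategory.congr_hom (φ.naturality f) (freeGen k S s (𝟙 c))
  have h2 := ConcreteCategory.congr_hom (ψ.naturality f) (freeGen k S s (𝟙 c))
  exact h1.trans ((congrArg _ (h c s)).trans h2.symm)

/-! ### Free modules generated in a full subcategory -/

section FullyFaithful

variable (ρ : D ⥤ C) [ρ.Full] (hS : ∀ c : C, S c → ρ.essImage c)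

/-- The generators of the restriction of a free module along a fully faithful functor whose
essential image contains the degrees of the generators. -/
def resFreeGen {c : C} (s : S c) : (ρ ⋙ freeModule k S).obj (hS c s).witness :=
  freeGen k S s (hS c s).getIso.inv

variable {ρ}

theorem freeGen_eq_map_resFreeGen {c : C} {d : D} (s : S c) (f : c ⟶ ρ.obj d) :
    freeGen k S s f = ((ρ ⋙ freeModule k S).map
      (ρ.preimage ((hS c s).getIso.hom ≫ f))).hom (resFreeGen (k := k) ρ hS s) := by
  simp [resFreeGen]

theorem resFree_hom_ext {N : CatMod k D} {φ ψ : ρ ⋙ freeModule k S ⟶ N}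
    (h : ∀ (c : C) (s : S c), (φ.app _).hom (resFreeGen ρ hS s) =
      (ψ.app _).hom (resFreeGen ρ hS s)) : φ = ψ := by
  ext d : 2
  refine ModuleCat.hom_ext (freeModule_linearMap_ext fun c s f => ?_)
  rw [freeGen_eq_map_resFreeGen hS]
  have h1 := ConcreteCategory.congr_hom
    (φ.naturality (ρ.preimage ((hS c s).getIso.hom ≫ f))) (resFreeGen ρ hS s)
  have h2 := ConcreteCategory.congr_hom
    (ψ.naturality (ρ.preimage ((hS c s).getIso.hom ≫ f))) (resFreeGen ρ hS s)
  exact h1.trans ((congrArg _ (h c s)).trans h2.symm)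

theorem exists_resFree_hom [ρ.Faithful] (N : CatMod k D)
    (y : ∀ (c : C) (s : S c), N.obj (hS c s).witness) :
    ∃ φ : ρ ⋙ freeModule k S ⟶ N, ∀ (c : C) (s : S c),
      (φ.app _).hom (resFreeGen ρ hS s) = y c s := by
  refine ⟨resFreeDesc ρ N (fun d c s f =>
    (N.map (ρ.preimage ((hS c s).getIso.hom ≫ f))).hom (y c s)) ?_, fun c s => ?_⟩
  · intro d e g c s f
    have : ρ.preimage ((hS c s).getIso.hom ≫ f ≫ ρ.map g) =
        ρ.preimage ((hS c s).getIso.hom ≫ f) ≫ g := ρ.map_injective (by simp)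
    rw [this]
    simp
  · refine (freeLift_freeGen _ _ _).trans ?_
    have : ρ.preimage ((hS c s).getIso.hom ≫ (hS c s).getIso.inv) = 𝟙 _ :=
      ρ.map_injective (by simp)
    dsimp only
    rw [this]
    simp

theorem epi_iff_forall_range_eq_top {L M : CatMod k C} (f : L ⟶ M) :
    Epi f ↔ ∀ c, LinearMap.range (f.app c).hom = ⊤ := by
  simp only [NatTrans.epi_iff_epi_app, ModuleCat.epi_iff_range_eq_top]

include hS in
-- By `hS` the restriction is again free, on the elements `resFreeGen`, so a lift may be chosen
-- generator by generator.
theorem projective_res_freeModule [ρ.Faithful] : Projective (ρ ⋙ freeModule k S) where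
  factors {E X} f e he := by
    rw [epi_iff_forall_range_eq_top] at he
    have hy (c : C) (s : S c) : ∃ y, (e.app _).hom y = (f.app _).hom (resFreeGen ρ hS s) :=
      LinearMap.range_eq_top.1 (he _) _
    choose y hy using hy
    obtain ⟨φ, hφ⟩ := exists_resFree_hom hS E y
    refine ⟨φ, resFree_hom_ext hS fun c s => ?_⟩
    exact (congrArg _ (hφ c s)).trans (hy c s)

theorem projective_freeModule : Projective (freeModule k S) :=
  projective_res_freeModule (ρ := 𝟭 C) fun c _ => ⟨c, ⟨Iso.refl c⟩⟩

include hS in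
/-- The free modules with generators in the degrees of a full subcategory are induced from it. -/
theorem isIso_counit_freeModule [ρ.Faithful] :
    IsIso ((ρ.lanAdjunction (ModuleCat.{u} k)).counit.app (freeModule k S)) := by
  let F : CatMod k C := freeModule k S
  let I : CatMod k C := ρ.lan.obj (ρ ⋙ F)
  let η : ρ ⋙ F ⟶ ρ ⋙ I := (ρ.lanAdjunction (ModuleCat.{u} k)).unit.app (ρ ⋙ F)
  let κ : I ⟶ F := (ρ.lanAdjunction (ModuleCat.{u} k)).counit.app F
  have hκ : η ≫ Functor.whiskerLeft ρ κ = 𝟙 _ :=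
    (ρ.lanAdjunction (ModuleCat.{u} k)).right_triangle_components F
  -- The candidate inverse of the counit sends each generator to its image under the unit,
  -- transported along the isomorphism from its degree to an object of `D`.
  let σ : F ⟶ I := freeDesc I fun c s =>
    (I.map (hS c s).getIso.hom).hom ((η.app _).hom (resFreeGen ρ hS s))
  have hσ (c : C) (s : S c) : (σ.app _).hom (resFreeGen ρ hS s) =
      (η.app _).hom (resFreeGen ρ hS s) := by
    refine (freeDesc_freeGen I _ s _).trans ?_
    have := I.map_comp (hS c s).getIso.hom (hS c s).getIso.inv
    rw [Iso.hom_inv_id, I.map_id] at this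
    exact (ConcreteCategory.congr_hom this _).symm
  have hησ : Functor.whiskerLeft ρ σ = η := resFree_hom_ext hS hσ
  have h1 : σ ≫ κ = 𝟙 F := by
    refine freeModule_hom_ext fun c s => ?_
    -- The triangle identity gives the equality on objects of `D`; naturality along the chosen
    -- isomorphism carries it to the degree `c`.
    have h3 : Functor.whiskerLeft ρ (σ ≫ κ) = 𝟙 _ := by
      rw [Functor.whiskerLeft_comp, hησ, hκ]
    have h4 := (σ ≫ κ).naturality (hS c s).getIso.hom
    rw [show (σ ≫ κ).app (ρ.obj (hS c s).witness) = 𝟙 _ from congr_app h3 _, Category.id_comp]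
      at h4
    rw [(cancel_epi (F.map (hS c s).getIso.hom)).1 (h4.trans (Category.comp_id _).symm)]
    rfl
  have h2 : κ ≫ σ = 𝟙 I := by
    refine ((ρ.lanAdjunction (ModuleCat.{u} k)).homEquiv (ρ ⋙ F) I).injective ?_
    rw [Adjunction.homEquiv_unit, Adjunction.homEquiv_unit]
    change η ≫ Functor.whiskerLeft ρ (κ ≫ σ) = η ≫ Functor.whiskerLeft ρ (𝟙 I)
    rw [Functor.whiskerLeft_comp, ← Category.assoc, hκ, Category.id_comp, hησ,
      Functor.whiskerLeft_id', Category.comp_id]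
  exact ⟨σ, h2, h1⟩

end FullyFaithful

end Free

/-! ### Superfluous epimorphisms and free covers -/

section Superfluous

variable {k : Type u} [CommRing k] {C D : Type} [SmallCategory C] [SmallCategory D]

theorem map_mem_jrad (M : CatMod k C) {b c : C} (u : b ⟶ c) (hu : ¬ IsIso u) (x : M.obj b) :
    (M.map u).hom x ∈ jrad M c :=
  (le_iSup_of_le b (le_iSup_of_le u (le_iSup_of_le hu le_rfl)) :
    LinearMap.range (M.map u).hom ≤ jrad M c) (LinearMap.mem_range_self _ x)

theorem jrad_le_iff {M : CatMod k C} {c : C} {N : Submodule k (M.obj c)} :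
    jrad M c ≤ N ↔ ∀ (b : C) (u : b ⟶ c), ¬ IsIso u → ∀ x, (M.map u).hom x ∈ N := by
  simp only [jrad, iSup_le_iff, LinearMap.range_le_iff_comap, Submodule.eq_top_iff',
    Submodule.mem_comap]

theorem map_app_map {L M : CatMod k C} (f : L ⟶ M) {b c : C} (u : b ⟶ c) (x : L.obj b) :
    (f.app c).hom ((L.map u).hom x) = (M.map u).hom ((f.app b).hom x) :=
  ConcreteCategory.congr_hom (f.naturality u) x

theorem map_comp_apply (M : CatMod k C) {b c d : C} (u : b ⟶ c) (v : c ⟶ d) (x : M.obj b) :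
    (M.map (u ≫ v)).hom x = (M.map v).hom ((M.map u).hom x) :=
  ConcreteCategory.congr_hom (M.map_comp u v) x

theorem jrad_le_comap {L M : CatMod k C} (f : L ⟶ M) (c : C) :
    jrad L c ≤ (jrad M c).comap (f.app c).hom := by
  rw [jrad_le_iff]
  intro b u hu x
  rw [Submodule.mem_comap, map_app_map]
  exact map_mem_jrad M u hu _

/-- The module `M` vanishes outside of `X`. -/
def IsSupportedIn (M : CatMod k C) (X : Set C) : Prop :=
  ∀ c, Nontrivial (M.obj c) → c ∈ X

theorem IsSupportedIn.of_epi {L M : CatMod k C} {X : Set C} (h : IsSupportedIn L X)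
    (f : L ⟶ M) [hf : Epi f] : IsSupportedIn M X := fun c _ =>
  h c (LinearMap.range_eq_top.1 ((epi_iff_forall_range_eq_top f).1 hf c)).nontrivial

theorem IsSupportedIn.of_mono {L M : CatMod k C} {X : Set C} (h : IsSupportedIn M X)
    (f : L ⟶ M) [Mono f] : IsSupportedIn L X := fun c _ =>
  h c ((ModuleCat.mono_iff_injective (f.app c)).1 inferInstance).nontrivial

/-- The non-isomorphisms that start in `X` strictly increase the rank function `δ`. -/
def IsRankOn (δ : C → ℕ) (X : Set C) : Prop :=
  ∀ ⦃b c : C⦄ (u : b ⟶ c), ¬ IsIso u → b ∈ X → δ b < δ c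

/-- Nakayama's lemma. -/
theorem eq_top_of_sup_jrad_eq_top {M : CatMod k C} {X : Set C} (hM : IsSupportedIn M X)
    {δ : C → ℕ} (hδ : IsRankOn δ X) (N : ∀ c, Submodule k (M.obj c))
    (hN : ∀ ⦃b c : C⦄ (u : b ⟶ c) (x : M.obj b), x ∈ N b → (M.map u).hom x ∈ N c)
    (h : ∀ c, N c ⊔ jrad M c = ⊤) (c : C) : N c = ⊤ := by
  induction hc : δ c using Nat.strong_induction_on generalizing c with
  | _ n ih =>
    rw [← h c, eq_comm, sup_eq_left, jrad_le_iff]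
    intro b u hu x
    refine hN u x ?_
    by_cases hb : Nontrivial (M.obj b)
    · rw [ih (δ b) (hc ▸ hδ u hu (hM b hb)) b rfl]
      trivial
    · rw [not_nontrivial_iff_subsingleton] at hb
      rw [Subsingleton.elim x 0]
      exact zero_mem _

theorem epi_of_range_sup_jrad_eq_top {L M : CatMod k C} {X : Set C} (hM : IsSupportedIn M X)
    {δ : C → ℕ} (hδ : IsRankOn δ X) (f : L ⟶ M)
    (h : ∀ c, LinearMap.range (f.app c).hom ⊔ jrad M c = ⊤) : Epi f := by
  rw [epi_iff_forall_range_eq_top]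
  refine eq_top_of_sup_jrad_eq_top hM hδ _ ?_ h
  rintro b c u _ ⟨x, rfl⟩
  exact ⟨(L.map u).hom x, map_app_map f u x⟩

/-- If `g ≫ f` is epic, then `L` is the sum of the image of `g` and the kernel of `f`. The latter
lies in the radical, so Nakayama's lemma makes `g` epic. -/
theorem isSuperfluousEpi_of_ker_le_jrad {L M : CatMod k C} {X : Set C} (hL : IsSupportedIn L X)
    {δ : C → ℕ} (hδ : IsRankOn δ X) (f : L ⟶ M) [Epi f]
    (h : ∀ c, LinearMap.ker (f.app c).hom ≤ jrad L c) : IsSuperfluousEpi f := by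
  refine ⟨inferInstance, fun K g => ⟨fun _ => inferInstance, fun hgf => ?_⟩⟩
  refine epi_of_range_sup_jrad_eq_top hL hδ g fun c => ?_
  rw [epi_iff_forall_range_eq_top] at hgf
  refine eq_top_iff.2 fun x _ => ?_
  obtain ⟨z, hz⟩ := LinearMap.range_eq_top.1 (hgf c) ((f.app c).hom x)
  have hx : x = (g.app c).hom z + (x - (g.app c).hom z) := by abel
  rw [hx]
  refine Submodule.add_mem_sup (LinearMap.mem_range_self _ z) (h c ?_)
  rw [LinearMap.mem_ker, map_sub, sub_eq_zero]
  exact hz.symm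

/-- Every value of `M` is spanned by the images of the values in the degrees `ρ a`. -/
def IsGeneratedFrom (ρ : D ⥤ C) (M : CatMod k C) : Prop :=
  ∀ b, ⨆ (a : D) (v : ρ.obj a ⟶ b), LinearMap.range (M.map v).hom = ⊤

theorem IsGeneratedFrom.of_epi {ρ : D ⥤ C} {L M : CatMod k C} (h : IsGeneratedFrom ρ L)
    (f : L ⟶ M) [hf : Epi f] : IsGeneratedFrom ρ M := fun b => by
  have hfb := (epi_iff_forall_range_eq_top f).1 hf b
  rw [eq_top_iff, ← hfb, LinearMap.range_eq_map, ← h b, Submodule.map_iSup]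
  refine iSup_mono fun a => ?_
  rw [Submodule.map_iSup]
  refine iSup_mono fun v => ?_
  rintro _ ⟨_, ⟨x, rfl⟩, rfl⟩
  exact ⟨(f.app _).hom x, (map_app_map f v x).symm⟩

theorem isGeneratedFrom_freeModule {S : C → Type u} (ρ : D ⥤ C)
    (hS : ∀ c : C, S c → ρ.essImage c) :
    IsGeneratedFrom ρ (freeModule k S) := fun b => by
  refine freeModule_submodule_eq_top _ fun c s f => ?_
  refine Submodule.mem_iSup_of_mem (hS c s).witness
    (Submodule.mem_iSup_of_mem ((hS c s).getIso.hom ≫ f) ?_)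
  exact ⟨freeGen k S s (hS c s).getIso.inv, by rw [freeModule_map_freeGen]; simp⟩

/-- The hypothesis gives `u` a right inverse, and the other composite is an endomorphism, hence the
identity. -/
theorem isIso_of_isIso_comp (hC : ∀ (c : C) (f : c ⟶ c), f = 𝟙 c) {a b c : C} (v : a ⟶ b)
    (u : b ⟶ c) (h : IsIso (v ≫ u)) : IsIso u :=
  ⟨inv (v ≫ u) ≫ v, hC _ _, by rw [Category.assoc, IsIso.inv_hom_id]⟩

/-- A non-isomorphism `u` into `ρ.obj c` may start outside `D`, but its source is spanned by images
of maps `v` from `D`. Each `v ≫ u` comes from `D` and is still not invertible, so nothing new enters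
the radical. -/
theorem IsGeneratedFrom.jrad_le (hC : ∀ (c : C) (f : c ⟶ c), f = 𝟙 c) {ρ : D ⥤ C} [ρ.Full]
    {M : CatMod k C} (h : IsGeneratedFrom ρ M) (c : D) :
    jrad M (ρ.obj c) ≤ jrad (ρ ⋙ M) c := by
  rw [jrad_le_iff]
  intro b u hu x
  have hx : x ∈ (⊤ : Submodule k (M.obj b)) := trivial
  suffices (⊤ : Submodule k (M.obj b)) ≤
      Submodule.comap (M.map u).hom (jrad (ρ ⋙ M) c) from this hx
  rw [← h b, iSup_le_iff]
  intro a
  rw [iSup_le_iff]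
  rintro v _ ⟨y, rfl⟩
  obtain ⟨w, hw⟩ := ρ.map_surjective (v ≫ u)
  rw [Submodule.mem_comap, ← map_comp_apply, ← hw]
  refine map_mem_jrad (ρ ⋙ M) w (fun hw' => hu (isIso_of_isIso_comp hC v u ?_)) y
  rw [← hw]
  infer_instance

end Superfluous

/-! ### Free covers and projective covers over a field -/

section FreeCover

variable {k : Type u} [Field k] {C : Type} [SmallCategory C]

/-- A basis element in degree `c` is either a generator of degree `c` itself or the image of a
generator under a non-isomorphism. The map `π` reads off the coordinates of the first kind. -/
theorem freeModule_sub_mem_jrad (hC : ∀ (c : C) (f : c ⟶ c), f = 𝟙 c)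
    (hC' : ∀ (b c : C) (f : b ⟶ c), IsIso f → b = c) (S : C → Type u) (c : C) :
    ∃ π : (freeModule k S).obj c →ₗ[k] (S c →₀ k), ∀ x, x -
      Finsupp.linearCombination k (fun s => freeGen k S s (𝟙 c)) (π x) ∈
        jrad (freeModule k S) c := by
  classical
  let π : (freeModule k S).obj c →ₗ[k] (S c →₀ k) := freeLift fun b s _ =>
    if h : b = c then Finsupp.single (h ▸ s) 1 else 0
  refine ⟨π, ?_⟩
  let N : Submodule k ((freeModule k S).obj c) := Submodule.comap (LinearMap.id -
    Finsupp.linearCombination k (fun s => freeGen k S s (𝟙 c)) ∘ₗ π) (jrad (freeModule k S) c)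
  suffices N = ⊤ from fun x => (this ▸ trivial : x ∈ N)
  refine freeModule_submodule_eq_top N fun b s f => ?_
  change freeGen k S s f - Finsupp.linearCombination k (fun s => freeGen k S s (𝟙 c))
    (π (freeGen k S s f)) ∈ jrad (freeModule k S) c
  rw [freeLift_freeGen]
  by_cases h : b = c
  · subst h
    rw [dif_pos rfl, Finsupp.linearCombination_single, one_smul, hC b f, sub_self]
    exact zero_mem _
  · rw [dif_neg h, map_zero, sub_zero]
    have := map_mem_jrad (freeModule k S) f (fun hf => h (hC' b c f hf)) (freeGen k S s (𝟙 b))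
    rwa [freeModule_map_freeGen, Category.id_comp] at this

/-- A module with bounded support has a free cover whose kernel lies in the radical. -/
theorem exists_freeModule_epi (hC : ∀ (c : C) (f : c ⟶ c), f = 𝟙 c)
    (hC' : ∀ (b c : C) (f : b ⟶ c), IsIso f → b = c) {X : Set C} {δ : C → ℕ} (hδ : IsRankOn δ X)
    {M : CatMod k C} (hM : IsSupportedIn M X) :
    ∃ (S : C → Type u) (f : freeModule k S ⟶ M), Epi f ∧
      (∀ c, LinearMap.ker (f.app c).hom ≤ jrad (freeModule k S) c) ∧
      ∀ c, S c → Nontrivial (spl M c) := by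
  -- The generators are lifts of a basis of `M.obj c` modulo the radical; this is where `k` must be
  -- a field.
  let β (c : C) := Module.Basis.ofVectorSpace k (spl M c)
  let S (c : C) : Type u := Module.Basis.ofVectorSpaceIndex k (spl M c)
  have hy (c : C) (s : S c) : ∃ y : M.obj c, (jrad M c).mkQ y = β c s :=
    Submodule.mkQ_surjective _ _
  choose y hy using hy
  let f : freeModule k S ⟶ M := freeDesc M y
  have hf (c : C) (s : S c) : (f.app c).hom (freeGen k S s (𝟙 c)) = y c s := by
    rw [freeDesc_freeGen]
    simp
  have hfl (c : C) (a : S c →₀ k) : (jrad M c).mkQ ((f.app c).hom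
      (Finsupp.linearCombination k (fun s => freeGen k S s (𝟙 c)) a)) = (β c).repr.symm a := by
    rw [Module.Basis.repr_symm_apply, Finsupp.apply_linearCombination,
      Finsupp.apply_linearCombination]
    congr 2
    funext s
    change (jrad M c).mkQ ((f.app c).hom (freeGen k S s (𝟙 c))) = β c s
    rw [hf, hy]
  refine ⟨S, f, ?_, fun c x hx => ?_, fun c s => ?_⟩
  · refine epi_of_range_sup_jrad_eq_top hM hδ f fun c => ?_
    refine eq_top_iff.2 fun x _ => ?_
    have h := hfl c ((β c).repr ((jrad M c).mkQ x))
    rw [LinearEquiv.symm_apply_apply, eq_comm, ← sub_eq_zero, ← map_sub, Submodule.mkQ_apply,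
      Submodule.Quotient.mk_eq_zero] at h
    rw [← add_sub_cancel ((f.app c).hom (Finsupp.linearCombination k
      (fun s => freeGen k S s (𝟙 c)) ((β c).repr ((jrad M c).mkQ x)))) x]
    exact Submodule.add_mem_sup (LinearMap.mem_range_self _ _) h
  -- The generator part of a kernel element `x` maps into the radical of `M`. Generators map to a
  -- basis modulo that radical, so `π x = 0` and `x` lies in the radical.
  · obtain ⟨π, hπ⟩ := freeModule_sub_mem_jrad (k := k) hC hC' S c
    have h := jrad_le_comap f c (hπ x)
    rw [Submodule.mem_comap, map_sub, LinearMap.mem_ker.1 hx, zero_sub, neg_mem_iff,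
      ← Submodule.Quotient.mk_eq_zero, ← Submodule.mkQ_apply, hfl,
      LinearEquiv.map_eq_zero_iff] at h
    have := hπ x
    rwa [h, map_zero, sub_zero] at this
  · exact ⟨β c s, 0, (β c).ne_zero s⟩

theorem nontrivial_spl_of_epi {L M : CatMod k C} (f : L ⟶ M) [hf : Epi f] (c : C)
    (h : Nontrivial (spl M c)) : Nontrivial (spl L c) := by
  rw [Submodule.Quotient.nontrivial_iff] at h ⊢
  intro hL
  refine h (eq_top_iff.2 fun x _ => ?_)
  obtain ⟨y, rfl⟩ := LinearMap.range_eq_top.1 ((epi_iff_forall_range_eq_top f).1 hf c) x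
  exact jrad_le_comap f c (hL ▸ trivial)

/-- Projective covers of modules with bounded support are free, and their kernel lies in the
radical. -/
theorem IsProjectiveCover.exists_iso_freeModule (hC : ∀ (c : C) (f : c ⟶ c), f = 𝟙 c)
    (hC' : ∀ (b c : C) (f : b ⟶ c), IsIso f → b = c) {X : Set C}
    (hX : ∀ ⦃b c : C⦄, (b ⟶ c) → b ∈ X → c ∈ X) {δ : C → ℕ} (hδ : IsRankOn δ X)
    {L M : CatMod k C} (hM : IsSupportedIn M X) {f : L ⟶ M} (hf : IsProjectiveCover f) :
    ∃ S : C → Type u, Nonempty (freeModule k S ≅ L) ∧ (∀ c, S c → Nontrivial (spl L c)) ∧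
      IsSupportedIn L X ∧ ∀ c, LinearMap.ker (f.app c).hom ≤ jrad L c := by
  obtain ⟨S, g, hg, hker, hS⟩ := exists_freeModule_epi hC hC' hδ hM
  have := hf.superfluous.epi
  -- Generators sit in `X` because `M` is nonzero there, and `X` is closed under targets of
  -- morphisms.
  have hF : IsSupportedIn (freeModule k S) X := fun c hc => by
    obtain ⟨b, ⟨s⟩, ⟨u⟩⟩ := nonempty_of_nontrivial_freeModule_obj hc
    have := hS b s
    exact hX u (hM b (Submodule.mkQ_surjective (jrad M b)).nontrivial)
  have hgc : IsProjectiveCover g :=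
    ⟨projective_freeModule, isSuperfluousEpi_of_ker_le_jrad hF hδ g hker⟩
  have := projective_freeModule (k := k) (S := S)
  have hφ := Projective.factorThru_comp g f
  have : IsIso (Projective.factorThru g f) :=
    hgc.isIso_of_lift hf (𝟙 M) _ (by rw [hφ, Category.comp_id])
  refine ⟨S, ⟨asIso (Projective.factorThru g f)⟩, fun c s => nontrivial_spl_of_epi f c (hS c s),
    hF.of_epi (Projective.factorThru g f), fun c x hx => ?_⟩
  obtain ⟨z, rfl⟩ := LinearMap.range_eq_top.1
    ((epi_iff_forall_range_eq_top (Projective.factorThru g f)).1 inferInstance c) x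
  refine jrad_le_comap _ c (hker c ?_)
  rw [LinearMap.mem_ker, ← hφ]
  exact hx

end FreeCover

/-! ### Projective covers under restriction and induction -/

section Restrict

variable {k : Type u} [Field k] {C D : Type} [SmallCategory C] [SmallCategory D]

/-- Restriction to a full subcategory that contains the degrees of all minimal generators preserves
projective covers of modules with bounded support. -/
theorem IsProjectiveCover.map_res (hC : ∀ (c : C) (f : c ⟶ c), f = 𝟙 c)
    (hC' : ∀ (b c : C) (f : b ⟶ c), IsIso f → b = c) {X : Set C}
    (hX : ∀ ⦃b c : C⦄, (b ⟶ c) → b ∈ X → c ∈ X) {δ : C → ℕ} (hδ : IsRankOn δ X)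
    {L M : CatMod k C} (hM : IsSupportedIn M X) {f : L ⟶ M} (hf : IsProjectiveCover f)
    (ρ : D ⥤ C) [ρ.Full] [ρ.Faithful] (hρ : ∀ c, Nontrivial (spl L c) → ρ.essImage c) :
    IsProjectiveCover ((res k ρ).map f) := by
  obtain ⟨S, ⟨e⟩, hS, hL, hker⟩ := hf.exists_iso_freeModule hC hC' hX hδ hM
  have hS' : ∀ c, S c → ρ.essImage c := fun c s => hρ c (hS c s)
  have hfe := hf.superfluous.epi
  have : Epi ((res k ρ).map f) := by
    rw [epi_iff_forall_range_eq_top] at hfe ⊢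
    exact fun c => hfe (ρ.obj c)
  refine ⟨Projective.of_iso ((res k ρ).mapIso e) (projective_res_freeModule hS'),
    isSuperfluousEpi_of_ker_le_jrad (X := ρ.obj ⁻¹' X) (δ := δ ∘ ρ.obj) (fun c => hL (ρ.obj c))
      (fun b c u hu => hδ (ρ.map u) fun h => hu (isIso_of_reflects_iso u ρ)) _ fun c => ?_⟩
  -- The kernel lies in the radical taken over `C`, which at objects of `D` is contained in the
  -- radical taken over `D`, as `L` is generated from `D`.
  exact (hker (ρ.obj c)).trans (((isGeneratedFrom_freeModule ρ hS').of_epi e.hom).jrad_le hC c)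

theorem IsProjectiveCover.isIso_counit (hC : ∀ (c : C) (f : c ⟶ c), f = 𝟙 c)
    (hC' : ∀ (b c : C) (f : b ⟶ c), IsIso f → b = c) {X : Set C}
    (hX : ∀ ⦃b c : C⦄, (b ⟶ c) → b ∈ X → c ∈ X) {δ : C → ℕ} (hδ : IsRankOn δ X)
    {L M : CatMod k C} (hM : IsSupportedIn M X) {f : L ⟶ M} (hf : IsProjectiveCover f)
    (ρ : D ⥤ C) [ρ.Full] [ρ.Faithful] (hρ : ∀ c, Nontrivial (spl L c) → ρ.essImage c) :
    IsIso ((ρ.lanAdjunction (ModuleCat.{u} k)).counit.app L) := by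
  obtain ⟨S, ⟨e⟩, hS, -⟩ := hf.exists_iso_freeModule hC hC' hX hδ hM
  exact (NatTrans.isIso_app_iff_of_iso _ e).1
    (isIso_counit_freeModule fun c s => hρ c (hS c s))

end Restrict

namespace PointedAffineSemigroup

variable {r n : ℕ} (Q : PointedAffineSemigroup r n)

/-! ### The action category and the toric module -/

theorem genMem_ne_zero (i : Fin n) : Q.genMem i ≠ 0 := fun h => by
  have h0 : Q.gen i = 0 := congrArg Subtype.val h
  exact Q.gen_irredundant i (h0.symm ▸ zero_mem _)

/-- This is pointedness: coordinates are natural numbers, so a vanishing sum has only vanishing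
summands, while irredundant generators are nonzero. -/
theorem eq_zero_of_monomialSum_eq_zero {m : Fin n →₀ ℕ} (h : Q.monomialSum m = 0) : m = 0 := by
  by_contra hm
  obtain ⟨i, hi⟩ := Finsupp.ne_iff.1 hm
  have hle : Finsupp.single i 1 ≤ m := by
    rw [Finsupp.single_le_iff]
    exact Nat.one_le_iff_ne_zero.2 hi
  have hs : Q.monomialSum (Finsupp.single i 1) = Q.genMem i :=
    (Finsupp.sum_single_index (h := fun i e => e • Q.genMem i) (zero_nsmul _)).trans (one_nsmul _)
  rw [← add_tsub_cancel_of_le hle, map_add, hs] at h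
  refine Q.genMem_ne_zero i (Subtype.ext (funext fun j => ?_))
  have := congrFun (congrArg Subtype.val h) j
  exact Nat.eq_zero_of_add_eq_zero_right this

theorem toDegree_injective : Function.Injective Q.toDegree := fun _ _ h =>
  Subtype.ext (funext fun i => Nat.cast_injective (congrFun h i))

theorem degreeOf_injective : Function.Injective Q.degreeOf := fun b c h => by
  rcases b with ⟨⟨⟩, b⟩
  rcases c with ⟨⟨⟩, c⟩
  obtain rfl : b = c := h
  rfl

theorem monomialOf_injective {c d : Q.ActCat} :
    Function.Injective (Q.monomialOf : (c ⟶ d) → (Fin n →₀ ℕ)) := fun _ _ h =>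
  Subtype.ext h

theorem monomialOf_id (c : Q.ActCat) : Q.monomialOf (𝟙 c) = 0 := rfl

theorem monomialOf_comp {b c d : Q.ActCat} (f : b ⟶ c) (g : c ⟶ d) :
    Q.monomialOf (f ≫ g) = Q.monomialOf g + Q.monomialOf f := rfl

theorem endo_eq_id (c : Q.ActCat) (f : c ⟶ c) : f = 𝟙 c := by
  refine Q.monomialOf_injective (Q.eq_zero_of_monomialSum_eq_zero (Q.toDegree_injective ?_))
  rw [map_zero]
  exact add_eq_right.1 (Q.monomialOf_spec f)

theorem eq_of_monomialOf_eq_zero {c d : Q.ActCat} (f : c ⟶ d) (h : Q.monomialOf f = 0) :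
    c = d := by
  refine Q.degreeOf_injective ?_
  rw [← Q.monomialOf_spec f, h, map_zero, map_zero, zero_add]

theorem eq_of_isIso (c d : Q.ActCat) (f : c ⟶ d) (hf : IsIso f) : c = d := by
  refine Q.eq_of_monomialOf_eq_zero f ?_
  have h := congrArg Q.monomialOf (IsIso.hom_inv_id f)
  rw [monomialOf_comp, monomialOf_id] at h
  exact (add_eq_zero.1 h).2

/-- The degrees that lie in `Q`. -/
def degreesIn : Set Q.ActCat := {c | ∃ q : Q.carrier, Q.toDegree q = Q.degreeOf c}

theorem mem_degreesIn_of_hom ⦃b c : Q.ActCat⦄ (f : b ⟶ c) (hb : b ∈ Q.degreesIn) :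
    c ∈ Q.degreesIn := by
  obtain ⟨q, hq⟩ := hb
  exact ⟨Q.monomialSum (Q.monomialOf f) + q, by rw [map_add, hq, Q.monomialOf_spec]⟩

/-- The total degree. -/
def totalDegree (c : Q.ActCat) : ℕ := ∑ i, (Q.degreeOf c i).toNat

theorem isRankOn_totalDegree : IsRankOn Q.totalDegree Q.degreesIn := by
  rintro b c f hf ⟨q, hq⟩
  have hm : Q.monomialSum (Q.monomialOf f) ≠ 0 := fun h => hf (by
    obtain rfl := Q.eq_of_monomialOf_eq_zero f (Q.eq_zero_of_monomialSum_eq_zero h)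
    rw [Q.endo_eq_id b f]
    infer_instance)
  -- On degrees in `Q` all coordinates are nonnegative, so the truncation by `toNat` loses nothing.
  have hb (i : Fin r) : (Q.degreeOf b i).toNat = (q : Fin r → ℕ) i := by
    rw [← hq]
    exact Int.toNat_natCast _
  have hc (i : Fin r) : (Q.degreeOf c i).toNat =
      (Q.monomialSum (Q.monomialOf f) : Fin r → ℕ) i + (q : Fin r → ℕ) i := by
    rw [← Q.monomialOf_spec f, ← hq, ← map_add]
    exact Int.toNat_natCast _
  obtain ⟨i, hi⟩ := Function.ne_iff.1 fun h => hm (Subtype.ext h)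
  simp only [totalDegree, hb, hc]
  exact Finset.sum_lt_sum (fun j _ => Nat.le_add_left _ _)
    ⟨i, Finset.mem_univ i, Nat.lt_add_of_pos_left (Nat.pos_of_ne_zero hi)⟩

variable (k : Type u) [Field k]

theorem isSupportedIn_toricModule : IsSupportedIn (Q.toricModule k) Q.degreesIn := fun c hc => by
  obtain ⟨⟨a, ha⟩, ha0⟩ := @exists_ne (Q.component k (Q.degreeOf c)) hc 0
  by_contra hcQ
  refine ha0 (Subtype.ext ?_)
  rw [← AddMonoidAlgebra.coeff_inj]
  exact Finsupp.support_eq_empty.1 (Finset.eq_empty_of_forall_notMem fun q hq => hcQ ⟨q, ha q hq⟩)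

/-- The sum of the coefficients of an element of the toric ring. -/
def coeffSum : Q.ToricRing k →ₐ[k] k := AddMonoidAlgebra.lift k k Q.carrier 1

theorem coeffSum_single (q : Q.carrier) (a : k) :
    Q.coeffSum k (AddMonoidAlgebra.single q a) = a := by
  simp [coeffSum]

/-- Since `toDegree` is injective, the component is spanned by the single monomial `t^q`, whose
coefficient sum is 1. -/
theorem bijective_coeffSum {c : Fin r → ℤ} {q : Q.carrier} (hq : Q.toDegree q = c) :
    Function.Bijective fun x : Q.component k c => Q.coeffSum k (x : Q.ToricRing k) := by
  have h1 (x : Q.component k c) :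
      ∃ a : k, (x : Q.ToricRing k) = AddMonoidAlgebra.single q a := by
    have hx : (x : Q.ToricRing k).coeff.support ⊆ {q} := fun q' hq' =>
      Finset.mem_singleton.2 (Q.toDegree_injective ((x.2 q' hq').trans hq.symm))
    obtain ⟨a, ha⟩ := Finsupp.support_subset_singleton'.1 hx
    exact ⟨a, AddMonoidAlgebra.coeff_injective ha⟩
  refine ⟨fun x y hxy => Subtype.ext ?_, fun a =>
    ⟨⟨AddMonoidAlgebra.single q a, ?_⟩, Q.coeffSum_single k q a⟩⟩
  · obtain ⟨a, ha⟩ := h1 x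
    obtain ⟨b, hb⟩ := h1 y
    simp only [ha, hb, coeffSum_single] at hxy ⊢
    rw [hxy]
  · subst hq
    exact AddMonoidAlgebra.single_mem_gradeBy Q.toDegree q a

/-- The restriction of the toric module to degrees that lie in `Q` is constant. -/
theorem nonempty_res_toricModule_iso_const {D : Type} [SmallCategory D] (ρ : D ⥤ Q.ActCat)
    (hρ : ∀ d, ρ.obj d ∈ Q.degreesIn) :
    Nonempty (ρ ⋙ Q.toricModule k ≅ (Functor.const D).obj (ModuleCat.of k k)) := by
  let t : ρ ⋙ Q.toricModule k ⟶ (Functor.const D).obj (ModuleCat.of k k) :=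
    { app := fun d => ModuleCat.ofHom
        ((Q.coeffSum k).toLinearMap ∘ₗ (Q.component k (Q.degreeOf (ρ.obj d))).subtype)
      naturality := fun d e f => by
        refine ModuleCat.hom_ext (LinearMap.ext fun (x : Q.component k _) => ?_)
        change Q.coeffSum k (Q.toricHom k (MvPolynomial.monomial (Q.monomialOf (ρ.map f)) 1) *
          (x : Q.ToricRing k)) = Q.coeffSum k (x : Q.ToricRing k)
        -- Multiplicativity of `coeffSum` suffices: monomials have coefficient sum 1.
        rw [map_mul, toricHom_monomial, coeffSum_single, one_mul] }
  have ht (d : D) : IsIso (t.app d) := by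
    obtain ⟨q, hq⟩ := hρ d
    exact (ConcreteCategory.isIso_iff_bijective (t.app d)).2 (Q.bijective_coeffSum k hq)
  have := NatIso.isIso_of_isIso_app t
  exact ⟨asIso t⟩

/-! ### Minimal resolutions of the toric module -/

section Resolution

variable {Q k} {P : ChainComplex (CatMod k Q.ActCat) ℕ} {ε : P.X 0 ⟶ Q.toricModule k}

theorem isSupportedIn_resolution (h : IsMinimalProjectiveResolution P ε) :
    ∀ m, IsSupportedIn (P.X m) Q.degreesIn
  | 0 => by
    obtain ⟨-, -, -, hs, -⟩ := h.cover_augmentation.exists_iso_freeModule Q.endo_eq_id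
      Q.eq_of_isIso Q.mem_degreesIn_of_hom Q.isRankOn_totalDegree (Q.isSupportedIn_toricModule k)
    exact hs
  | 1 => by
    obtain ⟨-, -, -, hs, -⟩ := h.cover_zero.exists_iso_freeModule Q.endo_eq_id
      Q.eq_of_isIso Q.mem_degreesIn_of_hom Q.isRankOn_totalDegree
      ((isSupportedIn_resolution h 0).of_mono (kernel.ι ε))
    exact hs
  | m + 2 => by
    obtain ⟨-, -, -, hs, -⟩ := (h.cover_succ m).exists_iso_freeModule Q.endo_eq_id
      Q.eq_of_isIso Q.mem_degreesIn_of_hom Q.isRankOn_totalDegree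
      ((isSupportedIn_resolution h (m + 1)).of_mono (kernel.ι _))
    exact hs

/-- Every term of a minimal projective resolution of the toric module is a projective cover of a
module that is supported in degrees of `Q`. -/
theorem exists_isProjectiveCover (h : IsMinimalProjectiveResolution P ε) :
    ∀ m, ∃ (M : CatMod k Q.ActCat) (f : P.X m ⟶ M),
      IsSupportedIn M Q.degreesIn ∧ IsProjectiveCover f
  | 0 => ⟨_, ε, Q.isSupportedIn_toricModule k, h.cover_augmentation⟩
  | 1 => ⟨_, _, (isSupportedIn_resolution h 0).of_mono (kernel.ι ε), h.cover_zero⟩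
  | m + 2 => ⟨_, _, (isSupportedIn_resolution h (m + 1)).of_mono (kernel.ι _), h.cover_succ m⟩

/-- The resolution at hand is itself the witness required by `bettiProperty`, so no comparison of
resolutions is needed. -/
theorem essImage_bettiInclusion (h : IsMinimalProjectiveResolution P ε) (m : ℕ) (c : Q.ActCat)
    (hc : Nontrivial (spl (P.X m) c)) : (bettiInclusion (Q.toricModule k)).essImage c :=
  ⟨⟨c, P, ε, h, Set.mem_iUnion.2 ⟨m, c, rfl, hc⟩⟩, ⟨Iso.refl _⟩⟩

theorem bettiProperty_le (c : BettiCategory (Q.toricModule k)) :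
    (bettiInclusion (Q.toricModule k)).obj c ∈ Q.degreesIn := by
  obtain ⟨c, P, ε, h, hc⟩ := c
  obtain ⟨m, b, hb, hbP⟩ := Set.mem_iUnion.1 hc
  obtain ⟨e⟩ := Quotient.exact hb
  exact Q.mem_degreesIn_of_hom e.hom (isSupportedIn_resolution h m b
    (Submodule.mkQ_surjective (jrad (P.X m) b)).nontrivial)

theorem isFree_resolution (h : IsMinimalProjectiveResolution P ε) (m : ℕ) : IsFree (P.X m) := by
  obtain ⟨M, f, hM, hf⟩ := exists_isProjectiveCover h m
  obtain ⟨S, ⟨e⟩, -⟩ := hf.exists_iso_freeModule Q.endo_eq_id Q.eq_of_isIso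
    Q.mem_degreesIn_of_hom Q.isRankOn_totalDegree hM
  exact ⟨S, ⟨e.symm⟩⟩

theorem isIso_counit_resolution (h : IsMinimalProjectiveResolution P ε) (m : ℕ) :
    IsIso (((bettiInclusion (Q.toricModule k)).lanAdjunction (ModuleCat.{u} k)).counit.app
      (P.X m)) := by
  obtain ⟨M, f, hM, hf⟩ := exists_isProjectiveCover h m
  exact hf.isIso_counit Q.endo_eq_id Q.eq_of_isIso
    Q.mem_degreesIn_of_hom Q.isRankOn_totalDegree hM _ (essImage_bettiInclusion h m)

/-- The toric module is nonzero in degree 0, so `P.X 0` has at least one generator. -/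
theorem nonempty_bettiCategory (h : IsMinimalProjectiveResolution P ε) :
    Nonempty (BettiCategory (Q.toricModule k)) := by
  obtain ⟨S, ⟨e⟩, hS, -⟩ := h.cover_augmentation.exists_iso_freeModule Q.endo_eq_id Q.eq_of_isIso
    Q.mem_degreesIn_of_hom Q.isRankOn_totalDegree (Q.isSupportedIn_toricModule k)
  have := h.cover_augmentation.superfluous.epi
  let o : Q.ActCat := ActionCategory.objEquiv _ Q.Degrees (0 : Fin r → ℤ)
  have ho : Nontrivial ((Q.toricModule k).obj o) :=
    (Q.bijective_coeffSum k (c := Q.degreeOf o) (q := 0) (map_zero Q.toDegree)).2.nontrivial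
  have ho' := (LinearMap.range_eq_top.1
    ((epi_iff_forall_range_eq_top (e.hom ≫ ε)).1 inferInstance o)).nontrivial
  obtain ⟨c, ⟨s⟩, -⟩ := nonempty_of_nontrivial_freeModule_obj ho'
  exact ⟨(essImage_bettiInclusion h 0 c (hS c s)).witness⟩

/-- The covers of a minimal resolution of the toric module restrict to projective covers over the
Betti category, and stay projective covers after restriction along an equivalence. -/
theorem isMinimalProjectiveResolution_res {D : Type} [SmallCategory D]
    (h : IsMinimalProjectiveResolution P ε) (α : D ⥤ BettiCategory (Q.toricModule k))
    [α.IsEquivalence] :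
    IsMinimalProjectiveResolution
      (((res k (α ⋙ bettiInclusion (Q.toricModule k))).mapHomologicalComplex _).obj P)
      ((res k (α ⋙ bettiInclusion (Q.toricModule k))).map ε) := by
  have key (m : ℕ) {M : CatMod k Q.ActCat} {f : P.X m ⟶ M} (hM : IsSupportedIn M Q.degreesIn)
      (hf : IsProjectiveCover f) :
      IsProjectiveCover ((res k (α ⋙ bettiInclusion (Q.toricModule k))).map f) :=
    (hf.map_res Q.endo_eq_id Q.eq_of_isIso Q.mem_degreesIn_of_hom Q.isRankOn_totalDegree hM
      (bettiInclusion (Q.toricModule k)) (essImage_bettiInclusion h m)).map_of_isEquivalence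
        (res k α)
  exact h.map _ (key 0 (Q.isSupportedIn_toricModule k) h.cover_augmentation)
    (key 1 ((isSupportedIn_resolution h 0).of_mono (kernel.ι ε)) h.cover_zero)
    (fun m => key (m + 2) ((isSupportedIn_resolution h (m + 1)).of_mono (kernel.ι _))
      (h.cover_succ m))

/-- A minimal resolution of the toric module is induced from its restriction to the Betti
category. -/
theorem nonempty_indResComplex_iso (h : IsMinimalProjectiveResolution P ε) :
    Nonempty (indResComplex k (bettiInclusion (Q.toricModule k))
      (𝟭 _ ⋙ bettiInclusion (Q.toricModule k)) P ≅ P) := by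
  have := isIso_counit_resolution h
  let adj := (bettiInclusion (Q.toricModule k)).lanAdjunction (ModuleCat.{u} k)
  exact ⟨HomologicalComplex.Hom.isoOfComponents (fun m => @asIso _ _ _ _ (adj.counit.app (P.X m)) (this m))
    (fun i j _ => (adj.counit.naturality (P.d i j)).symm)⟩

end Resolution

end PointedAffineSemigroup

end ToricBetti

end

theorem mainTheorem2 (k : Type*) [Field k] {r n r' n' : ℕ}
    (Q : ToricBetti.PointedAffineSemigroup r n) (Q' : ToricBetti.PointedAffineSemigroup r' n')
    (α : ToricBetti.BettiCategory (Q.toricModule k) ⥤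
      ToricBetti.BettiCategory (Q'.toricModule k)) (hα : α.IsEquivalence)
    (P' : ChainComplex (ToricBetti.CatMod k Q'.ActCat) ℕ)
    (ε' : P'.X 0 ⟶ Q'.toricModule k)
    (hP' : ToricBetti.IsMinimalFreeResolution P' ε') :
    ∃ ε : (ToricBetti.indResComplex k (ToricBetti.bettiInclusion (Q.toricModule k))
        (α ⋙ ToricBetti.bettiInclusion (Q'.toricModule k)) P').X 0 ⟶ Q.toricModule k,
      ToricBetti.IsMinimalFreeResolution
        (ToricBetti.indResComplex k (ToricBetti.bettiInclusion (Q.toricModule k))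
          (α ⋙ ToricBetti.bettiInclusion (Q'.toricModule k)) P') ε := by
  have h' := hP'.toIsMinimalProjectiveResolution
  obtain ⟨b'⟩ := ToricBetti.PointedAffineSemigroup.nonempty_bettiCategory h'
  -- A minimal resolution `P` of the toric module of `Q` is not constructed: any object of its Betti
  -- category carries one, and such an object exists because `α` is essentially surjective.
  obtain ⟨b, P, ε, h, -⟩ := α.objPreimage b'
  obtain ⟨e⟩ := Q.nonempty_res_toricModule_iso_const k
    (𝟭 _ ⋙ ToricBetti.bettiInclusion (Q.toricModule k))
    (fun d => ToricBetti.PointedAffineSemigroup.bettiProperty_le d)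
  obtain ⟨e'⟩ := Q'.nonempty_res_toricModule_iso_const k
    (α ⋙ ToricBetti.bettiInclusion (Q'.toricModule k))
    (fun d => ToricBetti.PointedAffineSemigroup.bettiProperty_le (α.obj d))
  -- Both restricted complexes resolve the constant functor over the Betti category of `Q`, so they
  -- are isomorphic.
  obtain ⟨φ⟩ := (ToricBetti.PointedAffineSemigroup.isMinimalProjectiveResolution_res h'
    α).nonempty_iso
    (ToricBetti.PointedAffineSemigroup.isMinimalProjectiveResolution_res h (𝟭 _)) (e' ≪≫ e.symm)
  obtain ⟨ψ⟩ := ToricBetti.PointedAffineSemigroup.nonempty_indResComplex_iso h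
  have H := h.of_iso ((((ToricBetti.ind k (ToricBetti.bettiInclusion
    (Q.toricModule k))).mapHomologicalComplex (ComplexShape.down ℕ)).mapIso φ) ≪≫ ψ)
    (Iso.refl _) (Category.comp_id _)
  exact ⟨_, H, ToricBetti.PointedAffineSemigroup.isFree_resolution H⟩
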